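/- Let $\mathscr H$ be a complex separable Hilbert space, let $\mathscr X$ be a locally compact Hausdorff space with Borel $\sigma$-algebra $\mathscr B(\mathscr X)$, let $\mu$ be a Borel probability measure on $\mathscr X$, and let $x\mapsto\rho_x$ be a Borel measurable map from $\mathscr X$ to the density operators on $\mathscr H$ (positive trace-class operators of trace one, with the trace norm). Then $x\mapsto \rho_x$ is Bochner integrable with respect to $\mu$ in the Banach space of trace-class operators. For $E\in\mathscr B(\mathscr X)$ put $\rho_E:=\int_E\rho_x\,\mu(\mathrm dx)$ (Bochner integral), which is a positive operator, and put $\rho:=\rho_{\mathscr X}$. For every $E\in\mathscr B(\mathscr X)$ there is a unique bounded operator $\Lambda_E$ on $\mathscr H$ with $$\|\Lambda_E\|\le 1,\qquad \ker(\rho)\subseteq\ker(\Lambda_E),\qquad \Lambda_E\,\rho^{1/2}=\rho_E^{1/2}.$$ The generalized pretty good measurement $$m^{\mathrm{PG}}(E):=\Lambda_E^\dagger\Lambda_E+\mu(E)\,\Pi_{\ker(\rho)},\qquad E\in\mathscr B(\mathscr X),$$ where $\Pi_{\ker(\rho)}$ is the orthogonal projection onto $\ker(\rho)$, is a probability operator-valued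 measure (POVM): $m^{\mathrm{PG}}(E)$ is a bounded positive operator for every $E\in\mathscr B(\mathscr X)$; $m^{\mathrm{PG}}(\mathscr X)$ is the identity; and for every sequence $(E_n)_{n\in\mathbb N}$ of pairwise disjoint Borel sets, $m^{\mathrm{PG}}\big(\bigcup_n E_n\big)=\sum_n m^{\mathrm{PG}}(E_n)$ with convergence in the strong operator topology. -/

import Mathlib

open MeasureTheory Filter Topology
open scoped ENNReal NNReal InnerProductSpace

noncomputable section

namespace QuantumEnsembles

/-! ## Trace-class operators and the trace norm -/

section TraceClassOperators

variable {H : Type*} [NormedAddCommGroup H] [InnerProductSpace ℂ H]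

/-- The trace norm `‖A‖₁ ∈ [0, ∞]` of a bounded operator `A` : the supremum of the sums
`∑ᵢ |⟪eᵢ, A fᵢ⟫|` over all pairs of finite orthonormal systems `(eᵢ)`, `(fᵢ)` of equal length.
It equals `Tr |A|`. -/
def traceNorm (A : H →L[ℂ] H) : ℝ≥0∞ :=
  ⨆ (n : ℕ) (e : Fin n → H) (f : Fin n → H) (_ : Orthonormal ℂ e) (_ : Orthonormal ℂ f),
    ∑ i, ‖⟪e i, A (f i)⟫_ℂ‖ₑ

theorem sum_le_traceNorm (A : H →L[ℂ] H) {n : ℕ} {e f : Fin n → H}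
    (he : Orthonormal ℂ e) (hf : Orthonormal ℂ f) :
    ∑ i, ‖⟪e i, A (f i)⟫_ℂ‖ₑ ≤ traceNorm A :=
  le_iSup_of_le n <| le_iSup_of_le e <| le_iSup_of_le f <| le_iSup_of_le he <|
    le_iSup_of_le hf le_rfl

theorem traceNorm_le {A : H →L[ℂ] H} {c : ℝ≥0∞}
    (h : ∀ (n : ℕ) (e f : Fin n → H), Orthonormal ℂ e → Orthonormal ℂ f →
      ∑ i, ‖⟪e i, A (f i)⟫_ℂ‖ₑ ≤ c) : traceNorm A ≤ c :=
  iSup_le fun n => iSup_le fun e => iSup_le fun f => iSup_le fun he => iSup_le fun hf =>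
    h n e f he hf

theorem traceNorm_zero : traceNorm (0 : H →L[ℂ] H) = 0 :=
  le_antisymm (traceNorm_le fun n e f _ _ => by simp) zero_le

theorem traceNorm_add_le (A B : H →L[ℂ] H) : traceNorm (A + B) ≤ traceNorm A + traceNorm B := by
  refine traceNorm_le fun n e f he hf => ?_
  calc ∑ i, ‖⟪e i, (A + B) (f i)⟫_ℂ‖ₑ
      ≤ ∑ i, (‖⟪e i, A (f i)⟫_ℂ‖ₑ + ‖⟪e i, B (f i)⟫_ℂ‖ₑ) := by
        refine Finset.sum_le_sum fun i _ => ?_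
        rw [add_apply, inner_add_right]
        exact enorm_add_le _ _
    _ ≤ _ := by
        rw [Finset.sum_add_distrib]
        exact add_le_add (sum_le_traceNorm A he hf) (sum_le_traceNorm B he hf)

theorem traceNorm_smul (c : ℂ) (A : H →L[ℂ] H) : traceNorm (c • A) = ‖c‖ₑ * traceNorm A := by
  simp only [traceNorm, ENNReal.mul_iSup, Finset.mul_sum, smul_apply, inner_smul_right,
    enorm_mul]

theorem enorm_le_traceNorm (A : H →L[ℂ] H) : ‖A‖ₑ ≤ traceNorm A := by
  by_cases hA : traceNorm A = ∞
  · simp [hA]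
  rw [← ENNReal.ofReal_toReal hA, ← ofReal_norm]
  refine ENNReal.ofReal_le_ofReal (A.opNorm_le_bound ENNReal.toReal_nonneg fun x => ?_)
  by_cases hx : x = 0
  · simp [hx]
  by_cases hAx : A x = 0
  · rw [hAx, norm_zero]; positivity
  have key : ∀ y : H, y ≠ 0 → Orthonormal ℂ (fun _ : Fin 1 => ((‖y‖⁻¹ : ℝ) : ℂ) • y) := by
    intro y hy
    refine ⟨fun _ => ?_, fun i j hij => absurd (Subsingleton.elim i j) hij⟩
    have : ‖y‖ ≠ 0 := norm_ne_zero_iff.2 hy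
    rw [norm_smul, Complex.norm_real, norm_inv, norm_norm, inv_mul_cancel₀ this]
  have h := sum_le_traceNorm A (key _ hAx) (key _ hx)
  have hx' : 0 < ‖x‖ := norm_pos_iff.2 hx
  have hAx' : 0 < ‖A x‖ := norm_pos_iff.2 hAx
  have e1 : ‖⟪((‖A x‖⁻¹ : ℝ) : ℂ) • A x, A (((‖x‖⁻¹ : ℝ) : ℂ) • x)⟫_ℂ‖ = ‖A x‖ / ‖x‖ := by
    rw [map_smul, inner_smul_left, inner_smul_right, norm_mul, norm_mul,
      inner_self_eq_norm_sq_to_K]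
    simp
    field_simp
  rw [Fin.sum_univ_one, ← ofReal_norm, e1] at h
  have h2 := (ENNReal.ofReal_le_iff_le_toReal hA).1 h
  rwa [div_le_iff₀ hx'] at h2

end TraceClassOperators

variable (H : Type*) [NormedAddCommGroup H] [InnerProductSpace ℂ H]

/-- The operators of finite trace norm. -/
def traceClassSubmodule : Submodule ℂ (H →L[ℂ] H) where
  carrier := {A | traceNorm A ≠ ∞}
  zero_mem' := by simp [traceNorm_zero]
  add_mem' {A B} hA hB := ne_top_of_le_ne_top (ENNReal.add_ne_top.2 ⟨hA, hB⟩) (traceNorm_add_le A B)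
  smul_mem' c A hA := by
    change traceNorm (c • A) ≠ ∞
    rw [traceNorm_smul]
    exact ENNReal.mul_ne_top enorm_ne_top hA

/-- The space of trace-class operators on `H`; it carries the trace norm (below), not the operator
norm. -/
def TraceClass : Type _ := traceClassSubmodule H

namespace TraceClass

instance : AddCommGroup (TraceClass H) := inferInstanceAs (AddCommGroup (traceClassSubmodule H))

instance : Module ℂ (TraceClass H) := inferInstanceAs (Module ℂ (traceClassSubmodule H))

/-- The inclusion of the trace-class operators into the bounded operators. -/
def toCLM : TraceClass H →ₗ[ℂ] (H →L[ℂ] H) := (traceClassSubmodule H).subtype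

instance : Coe (TraceClass H) (H →L[ℂ] H) := ⟨toCLM H⟩

/-- The trace norm as a real number. -/
instance : Norm (TraceClass H) := ⟨fun A => (traceNorm (A : H →L[ℂ] H)).toReal⟩

variable {H}

theorem norm_def (A : TraceClass H) : ‖A‖ = (traceNorm (A : H →L[ℂ] H)).toReal := rfl

theorem traceNorm_ne_top (A : TraceClass H) : traceNorm (A : H →L[ℂ] H) ≠ ∞ := A.2

theorem toCLM_injective : Function.Injective (toCLM H) := Subtype.val_injective

theorem norm_toCLM_le (A : TraceClass H) : ‖(A : H →L[ℂ] H)‖ ≤ ‖A‖ := by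
  have h := ENNReal.toReal_mono A.traceNorm_ne_top (enorm_le_traceNorm (A : H →L[ℂ] H))
  rwa [toReal_enorm] at h

variable (H)

theorem normCore : NormedSpace.Core ℂ (TraceClass H) where
  norm_nonneg _ := ENNReal.toReal_nonneg
  norm_smul c A := by
    rw [norm_def, norm_def, map_smul, traceNorm_smul, ENNReal.toReal_mul, toReal_enorm]
  norm_triangle A B := by
    rw [norm_def, norm_def, norm_def, map_add,
      ← ENNReal.toReal_add A.traceNorm_ne_top B.traceNorm_ne_top]
    exact ENNReal.toReal_mono (ENNReal.add_ne_top.2 ⟨A.traceNorm_ne_top, B.traceNorm_ne_top⟩)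
      (traceNorm_add_le _ _)
  norm_eq_zero_iff A := by
    constructor
    · intro h
      have h1 : ‖(A : H →L[ℂ] H)‖ ≤ 0 := h ▸ norm_toCLM_le A
      exact toCLM_injective (by rw [norm_le_zero_iff.1 h1, map_zero])
    · rintro rfl
      rw [norm_def, map_zero, traceNorm_zero, ENNReal.toReal_zero]

instance : NormedAddCommGroup (TraceClass H) := NormedAddCommGroup.ofCore (normCore H)

instance : NormedSpace ℂ (TraceClass H) := NormedSpace.ofCore (normCore H)

/-- The Borel σ-algebra of the trace norm. -/
instance : MeasurableSpace (TraceClass H) := borel _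

instance : BorelSpace (TraceClass H) := ⟨rfl⟩

instance [CompleteSpace H] : CompleteSpace (TraceClass H) := by
  refine Metric.complete_of_cauchySeq_tendsto fun u hu => ?_
  have hT : CauchySeq fun n => (u n : H →L[ℂ] H) := by
    rw [Metric.cauchySeq_iff'] at hu ⊢
    intro ε hε
    obtain ⟨N, hN⟩ := hu ε hε
    refine ⟨N, fun n hn => lt_of_le_of_lt ?_ (hN n hn)⟩
    rw [dist_eq_norm, dist_eq_norm, ← map_sub]
    exact norm_toCLM_le _
  obtain ⟨T, hT⟩ := cauchySeq_tendsto_of_complete hT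
  have key : ∀ ε : ℝ, 0 < ε → ∃ N, ∀ n ≥ N,
      traceNorm ((u n : H →L[ℂ] H) - T) ≤ ENNReal.ofReal ε := by
    intro ε hε
    obtain ⟨N, hN⟩ := Metric.cauchySeq_iff.1 hu ε hε
    refine ⟨N, fun n hn => traceNorm_le fun k e f he hf => ?_⟩
    have hlim : Tendsto (fun m => ∑ i, ‖⟪e i, ((u n : H →L[ℂ] H) - (u m : H →L[ℂ] H)) (f i)⟫_ℂ‖ₑ)
        atTop (𝓝 (∑ i, ‖⟪e i, ((u n : H →L[ℂ] H) - T) (f i)⟫_ℂ‖ₑ)) := by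
      refine tendsto_finsetSum _ fun i _ => Tendsto.enorm ?_
      have h1 : Tendsto (fun m => ((u n : H →L[ℂ] H) - (u m : H →L[ℂ] H)) (f i)) atTop
          (𝓝 (((u n : H →L[ℂ] H) - T) (f i))) :=
        ((ContinuousLinearMap.apply ℂ H (f i)).continuous.tendsto _).comp
          (tendsto_const_nhds.sub hT)
      exact tendsto_const_nhds.inner h1
    refine le_of_tendsto hlim (eventually_atTop.2 ⟨N, fun m hm => ?_⟩)
    refine (sum_le_traceNorm _ he hf).trans ?_
    have h2 := (hN n hn m hm).le
    rw [dist_eq_norm, norm_def, map_sub] at h2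
    have h3 : traceNorm ((u n : H →L[ℂ] H) - (u m : H →L[ℂ] H)) ≠ ∞ := by
      rw [← map_sub]; exact traceNorm_ne_top _
    exact (ENNReal.le_ofReal_iff_toReal_le h3 hε.le).2 h2
  have hTmem : traceNorm T ≠ ∞ := by
    obtain ⟨N, hN⟩ := key 1 one_pos
    have h1 : (u N : H →L[ℂ] H) - T ∈ traceClassSubmodule H :=
      ne_top_of_le_ne_top ENNReal.ofReal_ne_top (hN N le_rfl)
    have h2 := (traceClassSubmodule H).sub_mem (u N).2 h1
    have h3 : (u N).1 - ((u N : H →L[ℂ] H) - T) = T := sub_sub_cancel _ _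
    rw [h3] at h2
    exact h2
  obtain ⟨S, rfl⟩ : ∃ S : TraceClass H, toCLM H S = T :=
    ⟨(⟨T, hTmem⟩ : traceClassSubmodule H), rfl⟩
  refine ⟨S, Metric.tendsto_atTop.2 fun ε hε => ?_⟩
  obtain ⟨N, hN⟩ := key (ε / 2) (half_pos hε)
  refine ⟨N, fun n hn => lt_of_le_of_lt ?_ (half_lt_self hε)⟩
  rw [dist_eq_norm, norm_def, map_sub]
  exact ENNReal.toReal_le_of_le_ofReal (half_pos hε).le (hN n hn)

end TraceClass

section Density

variable {H : Type*} [NormedAddCommGroup H] [InnerProductSpace ℂ H] [CompleteSpace H]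

/-- An orthonormal (Hilbert) basis of `H`, used to evaluate the trace; the trace does not depend on
its choice. -/
def stdBasis (H : Type*) [NormedAddCommGroup H] [InnerProductSpace ℂ H] [CompleteSpace H] :
    HilbertBasis (exists_hilbertBasis ℂ H).choose ℂ H :=
  (exists_hilbertBasis ℂ H).choose_spec.choose

/-- The trace of a trace-class operator. -/
def TraceClass.trace (A : TraceClass H) : ℂ :=
  ∑' i, ⟪stdBasis H i, (A : H →L[ℂ] H) (stdBasis H i)⟫_ℂ

/-- A density operator: a positive (self-adjoint) trace-class operator of trace one. -/
structure IsDensityOperator (A : TraceClass H) : Prop where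
  isPositive : (A : H →L[ℂ] H).IsPositive
  trace_eq_one : A.trace = 1

end Density

/-! ## Ensembles, probability operator-valued measures and the pretty good measurement -/

/-- A generalized quantum ensemble: a Borel probability measure `μ` on `X` and a Borel measurable
family of density operators on `H`. -/
structure QuantumEnsemble (X : Type*) [MeasurableSpace X]
    (H : Type*) [NormedAddCommGroup H] [InnerProductSpace ℂ H] [CompleteSpace H] where
  /-- the distribution of the parameter -/
  μ : Measure X
  isProbabilityMeasure : IsProbabilityMeasure μ
  /-- the state with parameter `x` -/
  state : X → TraceClass H
  isDensityOperator : ∀ x, IsDensityOperator (state x)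
  measurable_state : Measurable state

/-- `m` (of which only the values at measurable sets matter) is a probability operator-valued
measure: positive, countably additive in the strong operator topology, and of total mass the
identity. -/
structure IsPOVM {X : Type*} [MeasurableSpace X]
    {H : Type*} [NormedAddCommGroup H] [InnerProductSpace ℂ H]
    (m : Set X → H →L[ℂ] H) : Prop where
  isPositive : ∀ E, MeasurableSet E → (m E).IsPositive
  univ_eq_one : m Set.univ = 1
  hasSum_iUnion : ∀ E : ℕ → Set X, (∀ n, MeasurableSet (E n)) →
    Pairwise (Function.onFun Disjoint E) →
    ∀ ψ : H, HasSum (fun n => m (E n) ψ) (m (⋃ n, E n) ψ)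

namespace QuantumEnsemble

variable {X : Type*} [MeasurableSpace X]
  {H : Type*} [NormedAddCommGroup H] [InnerProductSpace ℂ H] [CompleteSpace H]

/-- `ρ_E`, the Bochner integral over `E` of the states in the Banach space of trace-class
operators, regarded as a bounded operator. -/
def partialState (𝓔 : QuantumEnsemble X H) (E : Set X) : H →L[ℂ] H :=
  TraceClass.toCLM H (∫ x in E, 𝓔.state x ∂𝓔.μ)

/-- The average state `ρ` of the ensemble. -/
def averageState (𝓔 : QuantumEnsemble X H) : H →L[ℂ] H :=
  TraceClass.toCLM H (∫ x, 𝓔.state x ∂𝓔.μ)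

/-- The conditions `‖Λ‖ ≤ 1`, `ker ρ ⊆ ker Λ` and `Λ ρ^{1/2} = ρ_E^{1/2}` that characterize
`Λ_E`. -/
structure IsLambda (𝓔 : QuantumEnsemble X H) (E : Set X) (Λ : H →L[ℂ] H) : Prop where
  norm_le_one : ‖Λ‖ ≤ 1
  ker_le_ker : 𝓔.averageState.ker ≤ Λ.ker
  mul_sqrt : Λ * CFC.sqrt 𝓔.averageState = CFC.sqrt (𝓔.partialState E)

open Classical in
/-- The operator `Λ_E` (with the value `0` in case it did not exist). -/
def Lambda (𝓔 : QuantumEnsemble X H) (E : Set X) : H →L[ℂ] H :=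
  if h : ∃ Λ, 𝓔.IsLambda E Λ then h.choose else 0

/-- The generalized pretty good measurement
`m^PG(E) = Λ_E† Λ_E + μ(E) Π_{ker ρ}` of the ensemble. -/
def prettyGoodMeasurement (𝓔 : QuantumEnsemble X H) (E : Set X) : H →L[ℂ] H :=
  ContinuousLinearMap.adjoint (𝓔.Lambda E) * 𝓔.Lambda E +
    ((𝓔.μ.real E : ℝ) : ℂ) • 𝓔.averageState.ker.starProjection

end QuantumEnsemble

end QuantumEnsembles

end

namespace QuantumEnsembles

/-! ### Hilbert–Schmidt norms and Hölder's inequality for the trace norm -/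

section HilbertSchmidt

variable {H : Type*} [NormedAddCommGroup H] [InnerProductSpace ℂ H]

/-! Integrability. Density operators have trace norm at most 1, so only strong measurability is at
stake. For a density operator `A = S * S`, `S = √A` is Hilbert–Schmidt, and Hölder's inequality
shows that the compressions `P A P` to finite parts of a basis converge to `A` in trace norm
(`IsDensityOperator.tendsto_compress`). Each compression is a finite sum of measurable scalars times
fixed rank-one operators, and the basis is countable.

The measurement. Put `S = ρ^{1/2}`; the sum of `S.range` and `S.ker` is dense. As `ρ_E ≤ ρ`, we have
`‖ρ_E^{1/2} x‖ ≤ ‖S x‖`, and Douglas factorization gives `Λ_E`; density gives uniqueness. Likewise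
`M_E = Λ_E† Λ_E` is the only self-adjoint operator that kills `ker ρ` and satisfies `S M_E S = ρ_E`,
so finite additivity of `ρ_E` passes to `M_E`. For countable unions, let `G` be what remains after
removing finitely many sets: `‖Λ_G S φ‖² = ⟪φ, ρ_G φ⟫` tends to 0. Since the `Λ_G` are contractions
killing `ker ρ`, they tend strongly to 0, and so does `M_G`. Finally `Λ_X = 1 - Π`, and the term
`μ(E) Π` fills the gap on `ker ρ`. -/

theorem _root_.HilbertBasis.tsum_enorm_inner_sq {ι : Type*} (b : HilbertBasis ι ℂ H) (x : H) :
    ∑' i, ‖⟪b i, x⟫_ℂ‖ₑ ^ 2 = ‖x‖ₑ ^ 2 := by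
  have h := (b.hasSum_inner_mul_inner x x).mapL Complex.reCLM
  have h2 : HasSum (fun i => ‖⟪b i, x⟫_ℂ‖ ^ 2) (‖x‖ ^ 2) := by
    convert h using 1
    · ext i
      rw [← inner_conj_symm x (b i), ← Complex.normSq_eq_conj_mul_self, Complex.normSq_eq_norm_sq]
      simp only [Complex.reCLM_apply, Complex.ofReal_re]
    · rw [inner_self_eq_norm_sq_to_K]
      simp [← Complex.ofReal_pow]
  have h3 := ENNReal.ofReal_tsum_of_nonneg (fun i => sq_nonneg ‖⟪b i, x⟫_ℂ‖) h2.summable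
  rw [h2.tsum_eq] at h3
  simp_rw [ENNReal.ofReal_pow (norm_nonneg _), ofReal_norm] at h3
  exact h3.symm

/-- The squared Hilbert–Schmidt norm of an operator, computed in a Hilbert basis. -/
noncomputable def hilbertSchmidtSq {ι : Type*} (b : HilbertBasis ι ℂ H) (D : H →L[ℂ] H) : ℝ≥0∞ :=
  ∑' i, ‖D (b i)‖ₑ ^ 2

variable [CompleteSpace H]

/-- By Parseval both sides are the double sum of squared matrix entries, with the order of summation
exchanged. -/
theorem hilbertSchmidtSq_adjoint {ι : Type*} (b : HilbertBasis ι ℂ H) (D : H →L[ℂ] H) :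
    hilbertSchmidtSq b (ContinuousLinearMap.adjoint D) = hilbertSchmidtSq b D := by
  unfold hilbertSchmidtSq
  simp_rw [← b.tsum_enorm_inner_sq]
  rw [ENNReal.tsum_comm]
  refine tsum_congr fun i => tsum_congr fun j => ?_
  rw [ContinuousLinearMap.adjoint_inner_right, ← inner_conj_symm, RCLike.enorm_conj]

/-- Expand in `b` and exchange the sums; Bessel's inequality for `f` bounds the `i`-th term by `‖D†
(b i)‖²`. -/
theorem sum_enorm_sq_le_hilbertSchmidtSq {ι : Type*} (b : HilbertBasis ι ℂ H) (D : H →L[ℂ] H)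
    {n : ℕ} {f : Fin n → H} (hf : Orthonormal ℂ f) :
    ∑ k, ‖D (f k)‖ₑ ^ 2 ≤ hilbertSchmidtSq b D := by
  rw [← hilbertSchmidtSq_adjoint]
  simp_rw [← b.tsum_enorm_inner_sq (D _)]
  rw [← Summable.tsum_finsetSum fun _ _ => ENNReal.summable]
  refine ENNReal.tsum_le_tsum fun i => ?_
  have h := hf.sum_inner_products_le (ContinuousLinearMap.adjoint D (b i)) (s := Finset.univ)
  have h2 := ENNReal.ofReal_le_ofReal h
  rw [ENNReal.ofReal_sum_of_nonneg fun _ _ => sq_nonneg _] at h2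
  simp_rw [ENNReal.ofReal_pow (norm_nonneg _), ofReal_norm] at h2
  refine le_of_eq_of_le (Finset.sum_congr rfl fun k _ => ?_) h2
  rw [ContinuousLinearMap.adjoint_inner_right, ← inner_conj_symm, RCLike.enorm_conj]

/-- Move `C` to the left slot as its adjoint, then apply Cauchy–Schwarz in `H` and for the finite
sum. -/
theorem traceNorm_mul_le {ι : Type*} (b : HilbertBasis ι ℂ H) (C D : H →L[ℂ] H) :
    traceNorm (C * D) ≤
      hilbertSchmidtSq b C ^ (1 / 2 : ℝ) * hilbertSchmidtSq b D ^ (1 / 2 : ℝ) := by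
  refine traceNorm_le fun n e f he hf => ?_
  calc ∑ i, ‖⟪e i, (C * D) (f i)⟫_ℂ‖ₑ
      ≤ ∑ i, ‖ContinuousLinearMap.adjoint C (e i)‖ₑ * ‖D (f i)‖ₑ := by
        refine Finset.sum_le_sum fun i _ => ?_
        rw [mul_apply_eq_comp, ← ContinuousLinearMap.adjoint_inner_left]
        simp_rw [← ofReal_norm]
        rw [← ENNReal.ofReal_mul (norm_nonneg _)]
        exact ENNReal.ofReal_le_ofReal (norm_inner_le_norm _ _)
    _ ≤ _ := ENNReal.inner_le_Lp_mul_Lq _ _ _ Real.HolderConjugate.two_two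
    _ ≤ _ := by
        simp_rw [ENNReal.rpow_two]
        gcongr
        · rw [← hilbertSchmidtSq_adjoint]
          exact sum_enorm_sq_le_hilbertSchmidtSq b _ he
        · exact sum_enorm_sq_le_hilbertSchmidtSq b _ hf

omit [CompleteSpace H] in
theorem hilbertSchmidtSq_rankOne {ι : Type*} (b : HilbertBasis ι ℂ H) (x y : H) :
    hilbertSchmidtSq b (InnerProductSpace.rankOne ℂ x y) = ‖x‖ₑ ^ 2 * ‖y‖ₑ ^ 2 := by
  rw [mul_comm, ← b.tsum_enorm_inner_sq y, ← ENNReal.tsum_mul_right]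
  refine tsum_congr fun i => ?_
  rw [InnerProductSpace.rankOne_apply, enorm_smul, mul_pow, ← inner_conj_symm, RCLike.enorm_conj]

theorem traceNorm_rankOne_ne_top {x : H} (hx : ‖x‖ = 1) (y : H) :
    traceNorm (InnerProductSpace.rankOne ℂ x y) ≠ ∞ := by
  -- A unit vector `x` lets the operator factor into two Hilbert–Schmidt ones.
  have h : InnerProductSpace.rankOne ℂ x y =
      InnerProductSpace.rankOne ℂ x x * InnerProductSpace.rankOne ℂ x y := by
    ext z
    simp [inner_self_eq_norm_sq_to_K, hx]
  rw [h]
  refine ne_top_of_le_ne_top ?_ (traceNorm_mul_le (stdBasis H) _ _)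
  rw [hilbertSchmidtSq_rankOne, hilbertSchmidtSq_rankOne]
  refine ENNReal.mul_ne_top ?_ ?_ <;>
  exact ENNReal.rpow_ne_top_of_nonneg (by norm_num)
    (ENNReal.mul_ne_top (ENNReal.pow_ne_top enorm_ne_top) (ENNReal.pow_ne_top enorm_ne_top))

/-- The orthogonal projection onto the span of finitely many members of a Hilbert basis. -/
noncomputable def basisProj {ι : Type*} (b : HilbertBasis ι ℂ H) (s : Finset ι) : H →L[ℂ] H :=
  ∑ i ∈ s, InnerProductSpace.rankOne ℂ (b i) (b i)

theorem adjoint_basisProj {ι : Type*} (b : HilbertBasis ι ℂ H) (s : Finset ι) :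
    ContinuousLinearMap.adjoint (basisProj b s) = basisProj b s := by
  simp [basisProj, map_sum]

omit [CompleteSpace H] in
open Classical in
theorem basisProj_apply_basis {ι : Type*} (b : HilbertBasis ι ℂ H) (s : Finset ι) (j : ι) :
    basisProj b s (b j) = if j ∈ s then b j else 0 := by
  simp [basisProj, orthonormal_iff_ite.1 b.orthonormal]

omit [CompleteSpace H] in
theorem hilbertSchmidtSq_mul_basisProj_le {ι : Type*} (b : HilbertBasis ι ℂ H) (s : Finset ι)
    (D : H →L[ℂ] H) : hilbertSchmidtSq b (D * basisProj b s) ≤ hilbertSchmidtSq b D := by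
  refine ENNReal.tsum_le_tsum fun j => ?_
  rw [mul_apply_eq_comp, basisProj_apply_basis]
  split_ifs <;> simp

omit [CompleteSpace H] in
-- `D - D P` kills the basis vectors in `s` and agrees with `D` on the others, leaving the tail of a
-- convergent series.
theorem tendsto_hilbertSchmidtSq_sub_mul_basisProj {ι : Type*} (b : HilbertBasis ι ℂ H)
    (D : H →L[ℂ] H) (hD : hilbertSchmidtSq b D ≠ ∞) :
    Tendsto (fun s => hilbertSchmidtSq b (D - D * basisProj b s)) atTop (𝓝 0) := by
  refine (ENNReal.tendsto_tsum_compl_atTop_zero hD).congr fun s => ?_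
  refine (tsum_subtype {x | x ∉ s} fun i => ‖D (b i)‖ₑ ^ 2).trans ?_
  refine tsum_congr fun j => ?_
  rw [sub_apply, mul_apply_eq_comp, basisProj_apply_basis]
  by_cases hj : j ∈ s <;> simp [hj]

theorem traceNorm_mul_self_sub_compress_le {ι : Type*} (b : HilbertBasis ι ℂ H) (s : Finset ι)
    {S : H →L[ℂ] H} (hS : IsSelfAdjoint S) :
    traceNorm (S * S - basisProj b s * (S * S) * basisProj b s) ≤
      2 * (hilbertSchmidtSq b (S - S * basisProj b s) ^ (1 / 2 : ℝ) *
        hilbertSchmidtSq b S ^ (1 / 2 : ℝ)) := by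
  set P := basisProj b s with hP
  have hadj : ContinuousLinearMap.adjoint S = S := hS
  have hmul (A B : H →L[ℂ] H) : ContinuousLinearMap.adjoint (A * B) =
    ContinuousLinearMap.adjoint B * ContinuousLinearMap.adjoint A := star_mul A B
  have e : S * S - P * (S * S) * P = (S - P * S) * S + (P * S) * (S - S * P) := by noncomm_ring
  have h1 : hilbertSchmidtSq b (S - P * S) = hilbertSchmidtSq b (S - S * P) := by
    rw [← hilbertSchmidtSq_adjoint, map_sub, hmul, hadj, adjoint_basisProj]
  have h2 : hilbertSchmidtSq b (P * S) ≤ hilbertSchmidtSq b S := by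
    rw [← hilbertSchmidtSq_adjoint, hmul, hadj, adjoint_basisProj]
    exact hilbertSchmidtSq_mul_basisProj_le b s S
  rw [e, two_mul]
  refine (traceNorm_add_le _ _).trans (add_le_add ?_ ?_)
  · exact (traceNorm_mul_le b _ _).trans_eq (by rw [h1])
  · refine (traceNorm_mul_le b _ _).trans ?_
    rw [mul_comm]
    gcongr

end HilbertSchmidt

/-! ### Density operators and their finite compressions -/

section DensityOperator

variable {H : Type*} [NormedAddCommGroup H] [InnerProductSpace ℂ H] [CompleteSpace H]

theorem _root_.ContinuousLinearMap.isSelfAdjoint_sqrt (A : H →L[ℂ] H) :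
    IsSelfAdjoint (CFC.sqrt A) :=
  (CFC.sqrt_nonneg A).isSelfAdjoint

theorem _root_.ContinuousLinearMap.IsPositive.sqrt_mul_sqrt {A : H →L[ℂ] H} (hA : A.IsPositive) :
    CFC.sqrt A * CFC.sqrt A = A :=
  CFC.sqrt_mul_sqrt_self A (A.nonneg_iff_isPositive.2 hA)

theorem _root_.ContinuousLinearMap.IsPositive.inner_sqrt_sqrt {A : H →L[ℂ] H} (hA : A.IsPositive)
    (x y : H) : ⟪CFC.sqrt A x, CFC.sqrt A y⟫_ℂ = ⟪x, A y⟫_ℂ := by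
  rw [← (ContinuousLinearMap.isSelfAdjoint_sqrt A).adjoint_eq,
    ContinuousLinearMap.adjoint_inner_left,
    (ContinuousLinearMap.isSelfAdjoint_sqrt A).adjoint_eq, ← mul_apply_eq_comp, hA.sqrt_mul_sqrt]

theorem _root_.ContinuousLinearMap.IsPositive.inner_self_eq_norm_sqrt_sq {A : H →L[ℂ] H}
    (hA : A.IsPositive) (x : H) : ⟪x, A x⟫_ℂ = ((‖CFC.sqrt A x‖ ^ 2 : ℝ) : ℂ) := by
  rw [← hA.inner_sqrt_sqrt, inner_self_eq_norm_sq_to_K]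
  simp

theorem IsDensityOperator.hilbertSchmidtSq_sqrt {A : TraceClass H} (hA : IsDensityOperator A) :
    hilbertSchmidtSq (stdBasis H) (CFC.sqrt (A : H →L[ℂ] H)) = 1 := by
  have h := hA.trace_eq_one
  unfold TraceClass.trace at h
  simp_rw [hA.isPositive.inner_self_eq_norm_sqrt_sq] at h
  rw [← Complex.ofReal_tsum, Complex.ofReal_eq_one] at h
  have hs : Summable fun i => ‖CFC.sqrt (A : H →L[ℂ] H) (stdBasis H i)‖ ^ 2 := by
    -- A divergent `tsum` has the default value 0, which trace one excludes.
    by_contra hs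
    rw [tsum_eq_zero_of_not_summable hs] at h
    exact zero_ne_one h
  have h3 := ENNReal.ofReal_tsum_of_nonneg (fun i => sq_nonneg _) hs
  simp_rw [h, ENNReal.ofReal_pow (norm_nonneg _), ofReal_norm, ENNReal.ofReal_one] at h3
  exact h3.symm

theorem IsDensityOperator.norm_le_one {A : TraceClass H} (hA : IsDensityOperator A) :
    ‖A‖ ≤ 1 := by
  rw [TraceClass.norm_def]
  refine ENNReal.toReal_le_of_le_ofReal zero_le_one ?_
  rw [← hA.isPositive.sqrt_mul_sqrt]
  refine (traceNorm_mul_le (stdBasis H) _ _).trans ?_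
  simp [hA.hilbertSchmidtSq_sqrt]

/-- The rank-one trace-class operator `|bᵢ⟩⟨bⱼ|` of two members of a Hilbert basis. -/
noncomputable def TraceClass.basisRankOne {ι : Type*} (b : HilbertBasis ι ℂ H) (i j : ι) :
    TraceClass H :=
  (⟨InnerProductSpace.rankOne ℂ (b i) (b j), traceNorm_rankOne_ne_top (b.orthonormal.1 i) _⟩ :
    traceClassSubmodule H)

theorem TraceClass.toCLM_basisRankOne {ι : Type*} (b : HilbertBasis ι ℂ H) (i j : ι) :
    TraceClass.toCLM H (basisRankOne b i j) = InnerProductSpace.rankOne ℂ (b i) (b j) := rfl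

/-- The compression `P A P` of a trace-class operator to finitely many members of a Hilbert
basis. -/
noncomputable def TraceClass.compress {ι : Type*} (b : HilbertBasis ι ℂ H) (s : Finset ι)
    (A : TraceClass H) : TraceClass H :=
  ∑ i ∈ s, ∑ j ∈ s, ⟪b i, (A : H →L[ℂ] H) (b j)⟫_ℂ • basisRankOne b i j

theorem TraceClass.toCLM_compress {ι : Type*} (b : HilbertBasis ι ℂ H) (s : Finset ι)
    (A : TraceClass H) :
    toCLM H (compress b s A) = basisProj b s * (A : H →L[ℂ] H) * basisProj b s := by
  simp only [compress, map_sum, map_smul, toCLM_basisRankOne, basisProj, Finset.sum_mul,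
    Finset.mul_sum]
  refine Finset.sum_comm.trans (Finset.sum_congr rfl fun i _ => Finset.sum_congr rfl fun j _ => ?_)
  ext x
  simp [smul_smul, mul_comm]

variable (H) in
/-- The inclusion of the trace-class operators into the bounded operators is bounded. -/
noncomputable def TraceClass.toCLMCLM : TraceClass H →L[ℂ] (H →L[ℂ] H) :=
  (TraceClass.toCLM H).mkContinuous 1 fun A => by simpa using A.norm_toCLM_le

/-- The matrix entry `A ↦ ⟪x, A y⟫` as a bounded functional on the trace-class operators. -/
noncomputable def TraceClass.matrixEntry (x y : H) : TraceClass H →L[ℂ] ℂ :=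
  innerSL ℂ x ∘L ContinuousLinearMap.apply ℂ H y ∘L toCLMCLM H

theorem IsDensityOperator.tendsto_compress {A : TraceClass H} (hA : IsDensityOperator A) :
    Tendsto (fun s => TraceClass.compress (stdBasis H) s A) atTop (𝓝 A) := by
  have hfin : hilbertSchmidtSq (stdBasis H) (CFC.sqrt (A : H →L[ℂ] H)) ≠ ∞ := by
    rw [hA.hilbertSchmidtSq_sqrt]
    exact ENNReal.one_ne_top
  have h := ENNReal.Tendsto.const_mul (a := 2) ((tendsto_hilbertSchmidtSq_sub_mul_basisProj _ _
    hfin).ennrpow_const (1 / 2 : ℝ)) (Or.inr ENNReal.ofNat_ne_top)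
  rw [ENNReal.zero_rpow_of_pos (by norm_num), mul_zero] at h
  have h2 := (ENNReal.tendsto_toReal ENNReal.zero_ne_top).comp
    (tendsto_of_tendsto_of_tendsto_of_le_of_le tendsto_const_nhds h (fun _ => zero_le)
      fun s => (traceNorm_mul_self_sub_compress_le (stdBasis H) s
        (ContinuousLinearMap.isSelfAdjoint_sqrt (A : H →L[ℂ] H))).trans_eq
        (by rw [hA.hilbertSchmidtSq_sqrt, ENNReal.one_rpow, mul_one]))
  rw [tendsto_iff_norm_sub_tendsto_zero]
  refine h2.congr fun s => ?_
  rw [norm_sub_rev, TraceClass.norm_def, map_sub, TraceClass.toCLM_compress,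
    Function.comp_apply, hA.isPositive.sqrt_mul_sqrt]

end DensityOperator

/-! ### Bochner integrability of the ensemble -/

theorem _root_.Orthonormal.countable {H : Type*} [NormedAddCommGroup H] [InnerProductSpace ℂ H]
    [TopologicalSpace.SeparableSpace H] {ι : Type*} {v : ι → H} (hv : Orthonormal ℂ v) :
    Countable ι := by
  refine Pairwise.countable_of_isOpen_disjoint (s := fun i => Metric.ball (v i) (1 / 2)) ?_
    (fun i => Metric.isOpen_ball) fun i => Metric.nonempty_ball.2 (by norm_num)
  intro i j hij
  -- Distinct members are at distance `√2`, more than the sum 1 of the radii.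
  refine Metric.ball_disjoint_ball ?_
  have h : ‖v i - v j‖ ^ 2 = 2 := by
    rw [@norm_sub_sq ℂ, hv.2 hij, hv.1, hv.1]
    norm_num
  rw [dist_eq_norm]
  nlinarith [norm_nonneg (v i - v j)]

theorem QuantumEnsemble.integrable_state {X : Type*} [MeasurableSpace X]
    {H : Type*} [NormedAddCommGroup H] [InnerProductSpace ℂ H] [CompleteSpace H]
    [TopologicalSpace.SeparableSpace H] (𝓔 : QuantumEnsemble X H) :
    Integrable 𝓔.state 𝓔.μ := by
  have := 𝓔.isProbabilityMeasure
  -- Countability makes `atTop` on the finite index sets countably generated, as needed for limits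
  -- of measurable functions.
  have := (stdBasis H).orthonormal.countable
  have hs : StronglyMeasurable 𝓔.state := by
    refine stronglyMeasurable_of_tendsto atTop
      (f := fun s x => TraceClass.compress (stdBasis H) s (𝓔.state x)) (fun s => ?_)
      (tendsto_pi_nhds.2 fun x => (𝓔.isDensityOperator x).tendsto_compress)
    unfold TraceClass.compress
    refine Finset.stronglyMeasurable_fun_sum _ fun i _ =>
      Finset.stronglyMeasurable_fun_sum _ fun j _ => StronglyMeasurable.smul_const ?_ _
    exact ((TraceClass.matrixEntry (stdBasis H i) (stdBasis H j)).measurable.comp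
      𝓔.measurable_state).stronglyMeasurable
  exact Integrable.of_bound hs.aestronglyMeasurable 1
    (ae_of_all _ fun x => (𝓔.isDensityOperator x).norm_le_one)

/-! ### Range and kernel of a self-adjoint operator; Douglas factorization -/

section SelfAdjointRange

variable {H : Type*} [NormedAddCommGroup H] [InnerProductSpace ℂ H] [CompleteSpace H]

/-- A vector orthogonal to `C` is orthogonal to the range, hence lies in `S.ker ≤ C` and is
orthogonal to itself. -/
theorem eq_top_of_isClosed_of_range_le_of_ker_le {S : H →L[ℂ] H} (hS : IsSelfAdjoint S)
    {C : Submodule ℂ H} (hC : IsClosed (C : Set H)) (hr : S.range ≤ C) (hk : S.ker ≤ C) :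
    C = ⊤ := by
  have : CompleteSpace C := hC.completeSpace_coe
  rw [← Submodule.orthogonal_eq_bot_iff, Submodule.eq_bot_iff]
  intro x hx
  have h1 : x ∈ S.ker := by
    have h := Submodule.orthogonal_le hr hx
    rwa [ContinuousLinearMap.orthogonal_range, hS.adjoint_eq] at h
  exact inner_self_eq_zero.1 (hx x (hk h1))

theorem inner_apply_of_mem_ker {S : H →L[ℂ] H} (hS : IsSelfAdjoint S) {k : H} (hk : k ∈ S.ker)
    (x : H) : ⟪S x, k⟫_ℂ = 0 := by
  rw [← hS.adjoint_eq, ContinuousLinearMap.adjoint_inner_left, show S k = 0 from hk,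
    inner_zero_right]

theorem eq_of_mul_eq_of_ker_le {S Λ₁ Λ₂ : H →L[ℂ] H} (hS : IsSelfAdjoint S)
    (h : Λ₁ * S = Λ₂ * S) (h₁ : S.ker ≤ Λ₁.ker) (h₂ : S.ker ≤ Λ₂.ker) : Λ₁ = Λ₂ := by
  have hC : (Λ₁ - Λ₂).ker = ⊤ := by
    refine eq_top_of_isClosed_of_range_le_of_ker_le hS (Λ₁ - Λ₂).isClosed_ker ?_ fun x hx => ?_
    · rintro _ ⟨x, rfl⟩
      exact sub_eq_zero.2 (DFunLike.congr_fun h x)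
    · have e₁ : Λ₁ x = 0 := h₁ hx
      have e₂ : Λ₂ x = 0 := h₂ hx
      exact sub_eq_zero.2 (e₁.trans e₂.symm)
  ext x
  exact sub_eq_zero.1 (hC.ge (Submodule.mem_top (x := x)))

/-- Cancelling the right-hand `S` gives `S * T = 0`; taking adjoints, `T * S = 0`; cancelling again,
`T = 0`. -/
theorem eq_zero_of_conj_eq_zero_of_ker_le {S T : H →L[ℂ] H} (hS : IsSelfAdjoint S)
    (hT : IsSelfAdjoint T) (h : S * T * S = 0) (hk : S.ker ≤ T.ker) : T = 0 := by
  have hTS : T * S = 0 := by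
    have h1 : S * T = 0 := by
      refine eq_of_mul_eq_of_ker_le hS (by rw [h, zero_mul]) (fun x hx => ?_) fun x _ => rfl
      have e : T x = 0 := hk hx
      change S (T x) = 0
      rw [e, map_zero]
    have h2 := congrArg star h1
    rwa [star_mul, hS.star_eq, hT.star_eq, star_zero] at h2
  exact eq_of_mul_eq_of_ker_le hS (by rw [hTS, zero_mul]) hk fun x _ => rfl

/-- Douglas' factorization lemma for a self-adjoint `S` dominating `T`. -/
theorem exists_contraction_mul_eq {S T : H →L[ℂ] H} (hS : IsSelfAdjoint S)
    (h : ∀ x, ‖T x‖ ≤ ‖S x‖) :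
    ∃ Λ : H →L[ℂ] H, ‖Λ‖ ≤ 1 ∧ S.ker ≤ Λ.ker ∧ Λ * S = T := by
  -- `Λ` extends `S x + k ↦ T x`. The summand `S.ker` makes the domain dense and forces `Λ` to
  -- vanish there.
  let e : (H × S.ker) →ₗ[ℂ] H := (S : H →ₗ[ℂ] H).coprod S.ker.subtype
  let f : (H × S.ker) →ₗ[ℂ] H := (T : H →ₗ[ℂ] H) ∘ₗ LinearMap.fst ℂ H S.ker
  have he (p : H × S.ker) : e p = S p.1 + p.2 := rfl
  have hf (p : H × S.ker) : f p = T p.1 := rfl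
  have hd : DenseRange e := by
    have hC : (LinearMap.range e).topologicalClosure = ⊤ := by
      refine eq_top_of_isClosed_of_range_le_of_ker_le hS
        (Submodule.isClosed_topologicalClosure _) ?_ fun x hx => ?_
      · rintro _ ⟨x, rfl⟩
        exact Submodule.le_topologicalClosure _ ⟨(x, 0), by simp [he]⟩
      · exact Submodule.le_topologicalClosure _ ⟨(0, ⟨x, hx⟩), by simp [he]⟩
    have h2 := Submodule.dense_iff_topologicalClosure_eq_top.2 hC
    rwa [LinearMap.coe_range] at h2
  have hn (p : H × S.ker) : ‖f p‖ ≤ 1 * ‖e p‖ := by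
    rw [one_mul, he, hf]
    refine (h p.1).trans (le_of_sq_le_sq ?_ (norm_nonneg _))
    -- Pythagoras: `S x ⊥ k` gives `‖S x‖ ≤ ‖S x + k‖`, which also makes the map well defined.
    have := norm_add_sq_eq_norm_sq_add_norm_sq_of_inner_eq_zero (𝕜 := ℂ) (S p.1) (p.2 : H)
      (inner_apply_of_mem_ker hS p.2.2 p.1)
    nlinarith [norm_nonneg (p.2 : H)]
  have key := LinearMap.extendOfNorm_eq (f := f) (e := e) hd ⟨1, hn⟩
  refine ⟨f.extendOfNorm e, LinearMap.opNorm_extendOfNorm_le hd zero_le_one hn,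
    fun x hx => ?_, ?_⟩
  · have := key (0, ⟨x, hx⟩)
    simpa [he, hf] using this
  · ext x
    have := key (x, 0)
    simpa [he, hf] using this

theorem _root_.ContinuousLinearMap.IsPositive.ker_sqrt {A : H →L[ℂ] H} (hA : A.IsPositive) :
    (CFC.sqrt A).ker = A.ker := by
  ext x
  change CFC.sqrt A x = 0 ↔ A x = 0
  constructor <;> intro h
  · rw [← hA.sqrt_mul_sqrt, mul_apply_eq_comp, h, map_zero]
  · rw [← inner_self_eq_zero (𝕜 := ℂ), hA.inner_sqrt_sqrt, h, inner_zero_right]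

omit [CompleteSpace H] in
theorem isClosed_setOf_tendsto_norm_zero {α : Type*} {l : Filter α} {Λ : α → H →L[ℂ] H}
    (hΛ : ∀ a, ‖Λ a‖ ≤ 1) : IsClosed {x | Tendsto (fun a => Λ a x) l (𝓝 0)} := by
  refine isClosed_of_closure_subset fun x hx => ?_
  rw [Set.mem_ofPred_eq, Metric.tendsto_nhds]
  intro ε hε
  obtain ⟨y, hy, hxy⟩ := Metric.mem_closure_iff.1 hx (ε / 2) (half_pos hε)
  filter_upwards [Metric.tendsto_nhds.1 hy (ε / 2) (half_pos hε)] with a ha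
  rw [dist_zero_right] at ha ⊢
  calc ‖Λ a x‖ = ‖Λ a (x - y) + Λ a y‖ := by rw [map_sub, sub_add_cancel]
    _ ≤ ‖Λ a (x - y)‖ + ‖Λ a y‖ := norm_add_le _ _
    _ < ε / 2 + ε / 2 := by
        refine add_lt_add_of_le_of_lt ?_ ha
        refine ((Λ a).le_of_opNorm_le (hΛ a) _).trans ?_
        rw [one_mul, ← dist_eq_norm]
        exact hxy.le
    _ = ε := add_halves ε

theorem tendsto_apply_zero_of_range_of_ker {α : Type*} {l : Filter α} {Λ : α → H →L[ℂ] H}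
    (hΛ : ∀ a, ‖Λ a‖ ≤ 1) {S : H →L[ℂ] H} (hS : IsSelfAdjoint S)
    (hr : ∀ x, Tendsto (fun a => Λ a (S x)) l (𝓝 0)) (hk : ∀ a, S.ker ≤ (Λ a).ker) (x : H) :
    Tendsto (fun a => Λ a x) l (𝓝 0) := by
  let C : Submodule ℂ H :=
    { carrier := {x | Tendsto (fun a => Λ a x) l (𝓝 0)}
      zero_mem' := by simpa using tendsto_const_nhds
      add_mem' := fun hx hy => by simpa using Tendsto.add hx hy
      smul_mem' := fun c x hx => by simpa using Tendsto.const_smul hx c }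
  have hC : C = ⊤ := by
    refine eq_top_of_isClosed_of_range_le_of_ker_le hS (isClosed_setOf_tendsto_norm_zero hΛ) ?_
      fun x hx => ?_
    · rintro _ ⟨x, rfl⟩
      exact hr x
    · refine tendsto_const_nhds.congr fun a => ?_
      exact (show Λ a x = 0 from hk a hx).symm
  exact hC.ge (Submodule.mem_top (x := x))

end SelfAdjointRange

/-! ### Partial states and the operators `Λ_E` -/

namespace QuantumEnsemble

variable {X : Type*} [MeasurableSpace X]
  {H : Type*} [NormedAddCommGroup H] [InnerProductSpace ℂ H] [CompleteSpace H]

theorem partialState_univ (𝓔 : QuantumEnsemble X H) :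
    𝓔.partialState Set.univ = 𝓔.averageState := by
  rw [partialState, averageState, Measure.restrict_univ]

variable [TopologicalSpace.SeparableSpace H]

theorem inner_partialState (𝓔 : QuantumEnsemble X H) (E : Set X) (x y : H) :
    ⟪x, 𝓔.partialState E y⟫_ℂ = ∫ z in E, ⟪x, (𝓔.state z : H →L[ℂ] H) y⟫_ℂ ∂𝓔.μ :=
  ((TraceClass.matrixEntry x y).integral_comp_comm 𝓔.integrable_state.integrableOn).symm

theorem isPositive_partialState (𝓔 : QuantumEnsemble X H) (E : Set X) :
    (𝓔.partialState E).IsPositive := by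
  rw [ContinuousLinearMap.isPositive_iff_complex]
  intro x
  have h : ⟪x, 𝓔.partialState E x⟫_ℂ =
      ((∫ z in E, ‖CFC.sqrt (𝓔.state z : H →L[ℂ] H) x‖ ^ 2 ∂𝓔.μ : ℝ) : ℂ) := by
    rw [inner_partialState, ← integral_complex_ofReal]
    simp_rw [(𝓔.isDensityOperator _).isPositive.inner_self_eq_norm_sqrt_sq]
  rw [← inner_conj_symm, h, Complex.conj_ofReal]
  exact ⟨by simp, integral_nonneg fun _ => sq_nonneg _⟩

theorem isPositive_averageState (𝓔 : QuantumEnsemble X H) : 𝓔.averageState.IsPositive :=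
  𝓔.partialState_univ ▸ 𝓔.isPositive_partialState Set.univ

theorem partialState_diff (𝓔 : QuantumEnsemble X H) {E F : Set X} (hF : MeasurableSet F)
    (h : F ⊆ E) : 𝓔.partialState (E \ F) = 𝓔.partialState E - 𝓔.partialState F := by
  rw [partialState, setIntegral_sdiff hF 𝓔.integrable_state.integrableOn h, map_sub]
  rfl

theorem partialState_biUnion_finset (𝓔 : QuantumEnsemble X H) {E : ℕ → Set X}
    (hE : ∀ n, MeasurableSet (E n)) (hd : Pairwise (Function.onFun Disjoint E)) (s : Finset ℕ) :
    𝓔.partialState (⋃ n ∈ s, E n) = ∑ n ∈ s, 𝓔.partialState (E n) := by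
  rw [partialState, integral_biUnion_finset s (fun n _ => hE n) (hd.set_pairwise _)
    fun n _ => 𝓔.integrable_state.integrableOn, map_sum]
  rfl

theorem hasSum_partialState (𝓔 : QuantumEnsemble X H) {E : ℕ → Set X}
    (hE : ∀ n, MeasurableSet (E n)) (hd : Pairwise (Function.onFun Disjoint E)) :
    HasSum (fun n => 𝓔.partialState (E n)) (𝓔.partialState (⋃ n, E n)) :=
  (hasSum_integral_iUnion hE hd 𝓔.integrable_state.integrableOn).mapL (TraceClass.toCLMCLM H)

/-- The difference `ρ - ρ_E` is the partial state of the complement, hence positive. -/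
theorem norm_sqrt_partialState_le (𝓔 : QuantumEnsemble X H) {E : Set X} (hE : MeasurableSet E)
    (x : H) : ‖CFC.sqrt (𝓔.partialState E) x‖ ≤ ‖CFC.sqrt 𝓔.averageState x‖ := by
  refine le_of_sq_le_sq ?_ (norm_nonneg _)
  have h : ⟪x, 𝓔.partialState (Set.univ \ E) x⟫_ℂ =
      ⟪x, 𝓔.averageState x⟫_ℂ - ⟪x, 𝓔.partialState E x⟫_ℂ := by
    rw [𝓔.partialState_diff hE (Set.subset_univ _), partialState_univ, sub_apply, inner_sub_right]
  rw [(𝓔.isPositive_partialState _).inner_self_eq_norm_sqrt_sq,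
    (𝓔.isPositive_partialState _).inner_self_eq_norm_sqrt_sq,
    𝓔.isPositive_averageState.inner_self_eq_norm_sqrt_sq, ← Complex.ofReal_sub,
    Complex.ofReal_inj] at h
  linarith [sq_nonneg ‖CFC.sqrt (𝓔.partialState (Set.univ \ E)) x‖]

theorem IsLambda.unique {𝓔 : QuantumEnsemble X H} {E : Set X} {Λ₁ Λ₂ : H →L[ℂ] H}
    (h₁ : 𝓔.IsLambda E Λ₁) (h₂ : 𝓔.IsLambda E Λ₂) : Λ₁ = Λ₂ :=
  eq_of_mul_eq_of_ker_le (ContinuousLinearMap.isSelfAdjoint_sqrt 𝓔.averageState)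
    (h₁.mul_sqrt.trans h₂.mul_sqrt.symm)
    (𝓔.isPositive_averageState.ker_sqrt.trans_le h₁.ker_le_ker)
    (𝓔.isPositive_averageState.ker_sqrt.trans_le h₂.ker_le_ker)

theorem exists_isLambda (𝓔 : QuantumEnsemble X H) {E : Set X} (hE : MeasurableSet E) :
    ∃ Λ, 𝓔.IsLambda E Λ := by
  obtain ⟨Λ, h1, h2, h3⟩ := exists_contraction_mul_eq
    (ContinuousLinearMap.isSelfAdjoint_sqrt 𝓔.averageState) (𝓔.norm_sqrt_partialState_le hE)
  exact ⟨Λ, h1, 𝓔.isPositive_averageState.ker_sqrt.ge.trans h2, h3⟩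

theorem isLambda_Lambda (𝓔 : QuantumEnsemble X H) {E : Set X} (hE : MeasurableSet E) :
    𝓔.IsLambda E (𝓔.Lambda E) := by
  have h := 𝓔.exists_isLambda hE
  rw [Lambda, dif_pos h]
  exact h.choose_spec

theorem ker_sqrt_le_ker_Lambda (𝓔 : QuantumEnsemble X H) {E : Set X} (hE : MeasurableSet E) :
    (CFC.sqrt 𝓔.averageState).ker ≤ (𝓔.Lambda E).ker :=
  𝓔.isPositive_averageState.ker_sqrt.trans_le (𝓔.isLambda_Lambda hE).ker_le_ker

theorem inner_Lambda_sqrt (𝓔 : QuantumEnsemble X H) {E : Set X} (hE : MeasurableSet E) (x : H) :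
    ((‖𝓔.Lambda E (CFC.sqrt 𝓔.averageState x)‖ ^ 2 : ℝ) : ℂ) = ⟪x, 𝓔.partialState E x⟫_ℂ := by
  rw [← mul_apply_eq_comp, (𝓔.isLambda_Lambda hE).mul_sqrt,
    (𝓔.isPositive_partialState E).inner_self_eq_norm_sqrt_sq]

/-- By uniqueness it suffices that `1 - Π` meets the defining conditions; `Π` annihilates the range
of `ρ^{1/2}`. -/
theorem Lambda_univ (𝓔 : QuantumEnsemble X H) :
    𝓔.Lambda Set.univ = 1 - 𝓔.averageState.ker.starProjection := by
  refine (𝓔.isLambda_Lambda MeasurableSet.univ).unique ⟨?_, fun x hx => ?_, ?_⟩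
  · have h := (𝓔.averageState.ker)ᗮ.starProjection_norm_le
    rwa [Submodule.starProjection_orthogonal'] at h
  · change x - 𝓔.averageState.ker.starProjection x = 0
    rw [Submodule.starProjection_eq_self_iff.2 hx, sub_self]
  · rw [partialState_univ]
    ext x
    change CFC.sqrt 𝓔.averageState x -
      𝓔.averageState.ker.starProjection (CFC.sqrt 𝓔.averageState x) = _
    rw [(Submodule.starProjection_apply_eq_zero_iff _).2, sub_zero]
    rw [Submodule.mem_orthogonal']
    intro k hk
    refine inner_apply_of_mem_ker (ContinuousLinearMap.isSelfAdjoint_sqrt _) ?_ x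
    rwa [𝓔.isPositive_averageState.ker_sqrt]

/-- The part `Λ_E† Λ_E` of the pretty good measurement that is supported on the support of the
average state. -/
noncomputable def supportedPart (𝓔 : QuantumEnsemble X H) (E : Set X) : H →L[ℂ] H :=
  ContinuousLinearMap.adjoint (𝓔.Lambda E) * 𝓔.Lambda E

omit [TopologicalSpace.SeparableSpace H] in
theorem isPositive_supportedPart (𝓔 : QuantumEnsemble X H) (E : Set X) :
    (𝓔.supportedPart E).IsPositive :=
  ContinuousLinearMap.isPositive_adjoint_comp_self _

theorem sqrt_mul_supportedPart_mul_sqrt (𝓔 : QuantumEnsemble X H) {E : Set X}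
    (hE : MeasurableSet E) :
    CFC.sqrt 𝓔.averageState * 𝓔.supportedPart E * CFC.sqrt 𝓔.averageState = 𝓔.partialState E := by
  have h := (𝓔.isLambda_Lambda hE).mul_sqrt
  have h2 := congrArg star h
  rw [star_mul, (ContinuousLinearMap.isSelfAdjoint_sqrt _).star_eq,
    (ContinuousLinearMap.isSelfAdjoint_sqrt _).star_eq] at h2
  change _ * (star (𝓔.Lambda E) * _) * _ = _
  rw [← mul_assoc, h2, mul_assoc, h, (𝓔.isPositive_partialState E).sqrt_mul_sqrt]

theorem ker_sqrt_le_ker_supportedPart (𝓔 : QuantumEnsemble X H) {E : Set X}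
    (hE : MeasurableSet E) :
    (CFC.sqrt 𝓔.averageState).ker ≤ (𝓔.supportedPart E).ker := fun x hx => by
  have h : 𝓔.Lambda E x = 0 := 𝓔.ker_sqrt_le_ker_Lambda hE hx
  change ContinuousLinearMap.adjoint (𝓔.Lambda E) (𝓔.Lambda E x) = 0
  rw [h, map_zero]

theorem norm_supportedPart_apply_le (𝓔 : QuantumEnsemble X H) {E : Set X}
    (hE : MeasurableSet E) (x : H) : ‖𝓔.supportedPart E x‖ ≤ ‖𝓔.Lambda E x‖ := by
  have h : ‖ContinuousLinearMap.adjoint (𝓔.Lambda E)‖ ≤ 1 := by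
    rw [LinearIsometryEquiv.norm_map]
    exact (𝓔.isLambda_Lambda hE).norm_le_one
  exact ((ContinuousLinearMap.adjoint (𝓔.Lambda E)).le_of_opNorm_le h (𝓔.Lambda E x)).trans_eq
    (one_mul _)

/-! ### Countable additivity -/

section Additivity

variable (𝓔 : QuantumEnsemble X H) {E : ℕ → Set X} (hE : ∀ n, MeasurableSet (E n))
  (hd : Pairwise (Function.onFun Disjoint E))

include hE hd

theorem partialState_iUnion_diff (s : Finset ℕ) :
    𝓔.partialState ((⋃ n, E n) \ ⋃ n ∈ s, E n) =
      𝓔.partialState (⋃ n, E n) - ∑ n ∈ s, 𝓔.partialState (E n) := by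
  rw [𝓔.partialState_diff (s.measurableSet_biUnion fun n _ => hE n)
    (Set.iUnion₂_subset fun n _ => Set.subset_iUnion E n), 𝓔.partialState_biUnion_finset hE hd]

/-- The difference of the two sides kills `ker ρ^{1/2}`, and sandwiching it between `ρ^{1/2}`
reduces it to additivity of partial states. -/
theorem supportedPart_iUnion_diff (s : Finset ℕ) :
    𝓔.supportedPart ((⋃ n, E n) \ ⋃ n ∈ s, E n) =
      𝓔.supportedPart (⋃ n, E n) - ∑ n ∈ s, 𝓔.supportedPart (E n) := by
  have hU := MeasurableSet.iUnion hE
  have hG := hU.diff (s.measurableSet_biUnion fun n _ => hE n)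
  rw [← sub_eq_zero]
  refine eq_zero_of_conj_eq_zero_of_ker_le
    (ContinuousLinearMap.isSelfAdjoint_sqrt 𝓔.averageState) ?_ ?_ fun x hx => ?_
  · exact (𝓔.isPositive_supportedPart _).isSelfAdjoint.sub
      ((𝓔.isPositive_supportedPart _).isSelfAdjoint.sub
        (isSelfAdjoint_sum _ fun n _ => (𝓔.isPositive_supportedPart _).isSelfAdjoint))
  · simp only [mul_sub, sub_mul, Finset.mul_sum, Finset.sum_mul,
      𝓔.sqrt_mul_supportedPart_mul_sqrt hU, 𝓔.sqrt_mul_supportedPart_mul_sqrt hG,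
      𝓔.sqrt_mul_supportedPart_mul_sqrt (hE _)]
    rw [𝓔.partialState_iUnion_diff hE hd, sub_self]
  · have e {F : Set X} (hF : MeasurableSet F) : 𝓔.supportedPart F x = 0 :=
      𝓔.ker_sqrt_le_ker_supportedPart hF hx
    change (𝓔.supportedPart _ - (𝓔.supportedPart _ - ∑ n ∈ s, 𝓔.supportedPart (E n))) x = 0
    simp [e hU, e hG, e (hE _)]

theorem hasSum_supportedPart (ψ : H) :
    HasSum (fun n => 𝓔.supportedPart (E n) ψ) (𝓔.supportedPart (⋃ n, E n) ψ) := by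
  have hG (s : Finset ℕ) : MeasurableSet ((⋃ n, E n) \ ⋃ n ∈ s, E n) :=
    (MeasurableSet.iUnion hE).diff (s.measurableSet_biUnion fun n _ => hE n)
  have hr (φ : H) : Tendsto (fun s : Finset ℕ =>
      𝓔.Lambda ((⋃ n, E n) \ ⋃ n ∈ s, E n) (CFC.sqrt 𝓔.averageState φ)) atTop (𝓝 0) := by
    have h1 : Tendsto (fun s : Finset ℕ => 𝓔.partialState ((⋃ n, E n) \ ⋃ n ∈ s, E n))
        atTop (𝓝 0) := by
      simp_rw [𝓔.partialState_iUnion_diff hE hd]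
      simpa using (𝓔.hasSum_partialState hE hd).const_sub (𝓔.partialState (⋃ n, E n))
    have h2 : Tendsto (fun s : Finset ℕ =>
        ⟪φ, 𝓔.partialState ((⋃ n, E n) \ ⋃ n ∈ s, E n) φ⟫_ℂ) atTop (𝓝 0) := by
      have := ((innerSL ℂ φ ∘L ContinuousLinearMap.apply ℂ H φ).continuous.tendsto 0).comp h1
      rw [map_zero] at this
      exact this
    have h3 := h2.norm.sqrt
    rw [norm_zero, Real.sqrt_zero] at h3
    refine tendsto_zero_iff_norm_tendsto_zero.2 (h3.congr fun s => ?_)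
    rw [← 𝓔.inner_Lambda_sqrt (hG s), Complex.norm_real, norm_pow, norm_norm,
      Real.sqrt_sq (norm_nonneg _)]
  -- The uniform bound 1 carries convergence from the range and the kernel to all of `H`.
  have hz := tendsto_apply_zero_of_range_of_ker
    (fun s => (𝓔.isLambda_Lambda (hG s)).norm_le_one)
    (ContinuousLinearMap.isSelfAdjoint_sqrt 𝓔.averageState) hr
    (fun s => 𝓔.ker_sqrt_le_ker_Lambda (hG s)) ψ
  have hF : Tendsto (fun s : Finset ℕ => 𝓔.supportedPart ((⋃ n, E n) \ ⋃ n ∈ s, E n) ψ)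
      atTop (𝓝 0) :=
    squeeze_zero_norm (fun s => 𝓔.norm_supportedPart_apply_le (hG s) ψ)
      (tendsto_zero_iff_norm_tendsto_zero.1 hz)
  have := hF.const_sub (𝓔.supportedPart (⋃ n, E n) ψ)
  rw [sub_zero] at this
  refine this.congr fun s => ?_
  rw [𝓔.supportedPart_iUnion_diff hE hd]
  simp

omit [TopologicalSpace.SeparableSpace H] in
theorem hasSum_measureReal :
    HasSum (fun n => 𝓔.μ.real (E n)) (𝓔.μ.real (⋃ n, E n)) := by
  have := 𝓔.isProbabilityMeasure
  have h := measure_iUnion hd hE (μ := 𝓔.μ)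
  have hs := ENNReal.hasSum_toReal (h ▸ measure_ne_top 𝓔.μ _)
  rwa [← ENNReal.tsum_toReal_eq fun n => measure_ne_top 𝓔.μ (E n), ← h] at hs

end Additivity

/-! ### The POVM axioms -/

theorem isPOVM_prettyGoodMeasurement (𝓔 : QuantumEnsemble X H) :
    IsPOVM 𝓔.prettyGoodMeasurement where
  isPositive E _ := by
    refine (𝓔.isPositive_supportedPart E).add
      (ContinuousLinearMap.IsPositive.smul_of_nonneg ?_ ?_)
    · exact .of_isStarProjection isStarProjection_starProjection
    · exact_mod_cast measureReal_nonneg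
  univ_eq_one := by
    have := 𝓔.isProbabilityMeasure
    have hsa : star 𝓔.averageState.ker.starProjection = 𝓔.averageState.ker.starProjection :=
      isStarProjection_starProjection.isSelfAdjoint
    have hid : 𝓔.averageState.ker.starProjection * 𝓔.averageState.ker.starProjection =
      𝓔.averageState.ker.starProjection := isStarProjection_starProjection.isIdempotentElem
    -- The total is `(1 - Π)† (1 - Π) + Π`, with `Π` a self-adjoint idempotent.
    rw [prettyGoodMeasurement, ← ContinuousLinearMap.star_eq_adjoint, Lambda_univ, star_sub,
      star_one, hsa, probReal_univ, Complex.ofReal_one, one_smul, mul_sub, sub_mul, sub_mul, hid]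
    simp
  hasSum_iUnion E hE hd ψ :=
    (𝓔.hasSum_supportedPart hE hd ψ).add
      ((Complex.hasSum_ofReal.2 (𝓔.hasSum_measureReal hE hd)).smul_const
        (𝓔.averageState.ker.starProjection ψ))

end QuantumEnsemble

end QuantumEnsembles

theorem theorem1
    {X : Type*} [TopologicalSpace X] [T2Space X] [LocallyCompactSpace X]
    [MeasurableSpace X] [BorelSpace X]
    {H : Type*} [NormedAddCommGroup H] [InnerProductSpace ℂ H] [CompleteSpace H]
    [TopologicalSpace.SeparableSpace H]
    (𝓔 : QuantumEnsembles.QuantumEnsemble X H) :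
    MeasureTheory.Integrable 𝓔.state 𝓔.μ ∧
    (∀ E : Set X, MeasurableSet E → (𝓔.partialState E).IsPositive) ∧
    (∀ E : Set X, MeasurableSet E → ∃! Λ : H →L[ℂ] H, 𝓔.IsLambda E Λ) ∧
    QuantumEnsembles.IsPOVM 𝓔.prettyGoodMeasurement :=
  ⟨𝓔.integrable_state, fun E _ => 𝓔.isPositive_partialState E,
    fun _ hE => ⟨_, 𝓔.isLambda_Lambda hE, fun _ h => h.unique (𝓔.isLambda_Lambda hE)⟩,
    𝓔.isPOVM_prettyGoodMeasurement⟩
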